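/- Consider a bipartite caching network with $n$ users, $m$ caches and a library of $N$ files. Let $\partial^+(i)$ be the set of caches connected to user $i$; every cache is connected to at most $d$ users and has capacity $C\in\mathbb{N}$. At each slot $t\ge 1$ every user requests at most one file: the request vector $\boldsymbol{x}_t=(x^i_{t,f})\in\{0,1\}^{nN}$ satisfies $\sum_f x^i_{t,f}\le 1$ for every $i$. The request sequence is arbitrary but fixed in advance (oblivious adversary). Put $\boldsymbol{X}_t=\sum_{\tau=1}^{t-1}\boldsymbol{x}_\tau$. Let $$\mathcal{Y}_{\rm rel}=\Big\{\boldsymbol{y}\in[0,1]^{mN}:\ \sum_f y^j_f\le C\ \ \forall j\Big\},$$ $$\mathcal{Z}_{\rm rel}=\Big\{(\boldsymbol{z},\boldsymbol{y})\in[0,1]^{nN}\times\mathcal{Y}_{\rm rel}:\ z^i_f\le\sum_{j\in\partial^+(i)}y^j_f\ \ \forall i,f\Big\}.$$ For a learning rate sequence $(\eta_t)_{t\ge1}$, LeadCache with the relaxed action set draws once a vector $\boldsymbol{\gamma}\in\mathbb{R}^{nN}$ with i.i.d. standard Gaussian components and at each slot $t\ge 1$ plays $$(\boldsymbol{z}_t,\boldsymbol{y}_t)\in\arg\max_{(\boldsymbol{z},\boldsymbol{y})\in\mathcal{Z}_{\rm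 rel}}\langle\boldsymbol{z},\boldsymbol{X}_t+\eta_t\boldsymbol{\gamma}\rangle ,$$ ties being broken in any measurable way. Its expected regrets up to time $T$, for the virtual reward $\langle\boldsymbol{x},\boldsymbol{z}\rangle$ and for the cache-hit reward $q(\boldsymbol{x},\boldsymbol{y})=\sum_{i,f}x^i_f\min\big(1,\sum_{j\in\partial^+(i)}y^j_f\big)$, are $$\mathbb{E}\tilde R_T=\max_{(\boldsymbol{z},\boldsymbol{y})\in\mathcal{Z}_{\rm rel}}\sum_{t=1}^T\langle\boldsymbol{x}_t,\boldsymbol{z}\rangle-\mathbb{E}\sum_{t=1}^T\langle\boldsymbol{x}_t,\boldsymbol{z}_t\rangle,$$ $$\mathbb{E}R_T=\max_{\boldsymbol{y}\in\mathcal{Y}_{\rm rel}}\sum_{t=1}^Tq(\boldsymbol{x}_t,\boldsymbol{y})-\mathbb{E}\sum_{t=1}^Tq(\boldsymbol{x}_t,\boldsymbol{y}_t).$$ Proposition. There are absolute constants $K>0$ and $k\in\mathbb{N}$ such that for all $n,m,N,C,d$ there is $\beta>0$, depending only on these five numbers, for which the following holds. With the learning rates $\eta_t=\beta\sqrt t$,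 for every such network, every request sequence and every horizon $T$, both $\mathbb{E}\tilde R_T$ and $\mathbb{E}R_T$ are at most $$\kappa_1\,n^{3/4}\sqrt{dmCT},\qquad \kappa_1=K\,(1+\ln(Nn))^{k}$$ (with the convention $\ln 0=0$). -/

import Mathlib

open MeasureTheory ProbabilityTheory

namespace LeadCache

/-- A bipartite caching network with `n` users and `m` caches, in which every cache is
connected to at most `d` users. -/
structure Network (n m d : ℕ) where
  /-- the set of (user, cache) edges -/
  edges : Finset (Fin n × Fin m)
  degree_le : ∀ j : Fin m, (Finset.univ.filter fun i : Fin n => (i, j) ∈ edges).card ≤ d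

/-- The set of caches connected to the user `i`. -/
def Network.cachesOf {n m d : ℕ} (G : Network n m d) (i : Fin n) : Finset (Fin m) :=
  Finset.univ.filter fun j => (i, j) ∈ G.edges

/-- Vectors indexed by (user, file) pairs: requests, cumulative requests, virtual cache
configurations, and Gaussian perturbations. -/
abbrev UserVec (n N : ℕ) : Type := Fin n × Fin N → ℝ

/-- Vectors indexed by (cache, file) pairs: physical cache configurations. -/
abbrev CacheVec (m N : ℕ) : Type := Fin m × Fin N → ℝ

/-- The requests of one time slot: a 0-1 vector in which every user requests at most one file. -/
def IsRequest {n N : ℕ} (x : UserVec n N) : Prop :=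
  (∀ p, x p = 0 ∨ x p = 1) ∧ ∀ i : Fin n, ∑ f : Fin N, x (i, f) ≤ 1

/-- Fractional physical configurations: every cache holds fractions of files of total size at
most its capacity `C`. -/
def Yrel (m N C : ℕ) : Set (CacheVec m N) :=
  {y | (∀ p, 0 ≤ y p ∧ y p ≤ 1) ∧ ∀ j : Fin m, ∑ f : Fin N, y (j, f) ≤ (C : ℝ)}

/-- The relaxed action set: pairs `(z, y)` of a fractional virtual configuration `z` and a
fractional physical configuration `y` that supports it. -/
def Zrel {n m d : ℕ} (G : Network n m d) (N C : ℕ) : Set (UserVec n N × CacheVec m N) :=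
  {a | a.2 ∈ Yrel m N C ∧ (∀ p, 0 ≤ a.1 p ∧ a.1 p ≤ 1) ∧
    ∀ (i : Fin n) (f : Fin N), a.1 (i, f) ≤ ∑ j ∈ G.cachesOf i, a.2 (j, f)}

/-- The inner product `⟨x, z⟩`; this is the virtual reward when `x` is a request vector and `z` a
virtual configuration. -/
def virtualReward {n N : ℕ} (x z : UserVec n N) : ℝ :=
  ∑ p, x p * z p

/-- The physical reward (number of cache hits)
`∑ i, x^i ⬝ min (1, ∑ j connected to i, y^j)`, with a componentwise minimum. -/
def physicalReward {n m d N : ℕ} (G : Network n m d) (x : UserVec n N) (y : CacheVec m N) : ℝ :=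
  ∑ i : Fin n, ∑ f : Fin N, x (i, f) * min 1 (∑ j ∈ G.cachesOf i, y (j, f))

/-- The cumulative requests before slot `t`: the sum of `x τ` over `1 ≤ τ ≤ t - 1`. -/
def cumRequests {n N : ℕ} (x : ℕ → UserVec n N) (t : ℕ) : UserVec n N :=
  ∑ τ ∈ Finset.Ico 1 t, x τ

/-- The action `a` lies in the relaxed action set, and its virtual part maximizes the linear
objective `⟨θ, ·⟩` over that set. -/
def IsMaximizer {n m d N : ℕ} (G : Network n m d) (C : ℕ) (θ : UserVec n N)
    (a : UserVec n N × CacheVec m N) : Prop :=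
  a ∈ Zrel G N C ∧ ∀ b ∈ Zrel G N C, virtualReward θ b.1 ≤ virtualReward θ a.1

/-- The random actions `a 1, a 2, …` are those of the follow-the-perturbed-leader policy LeadCache
over the relaxed action set, with learning rates `η` and against the request sequence `x`: one
perturbation `γ` with i.i.d. standard Gaussian components is drawn once and for all, and in every
slot `t ≥ 1` the action maximizes `⟨X_t + η_t γ, z⟩`, `X_t` being the cumulative requests.
Ties may be broken in any measurable way. -/
structure IsRelaxedLeadCache {n m d N : ℕ} (G : Network n m d) (C : ℕ) (η : ℕ → ℝ)
    (x : ℕ → UserVec n N) {Ω : Type*} [MeasurableSpace Ω] (P : Measure Ω)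
    (γ : Ω → UserVec n N) (a : ℕ → Ω → UserVec n N × CacheVec m N) : Prop where
  gaussian : HasLaw γ (Measure.pi fun _ : Fin n × Fin N => gaussianReal 0 1) P
  aemeasurable : ∀ t, 1 ≤ t → AEMeasurable (a t) P
  maximizer : ∀ t, 1 ≤ t → ∀ᵐ ω ∂P, IsMaximizer G C (cumRequests x t + η t • γ ω) (a t ω)

/-- The expected regret up to time `T` for the virtual rewards: the total reward of the best fixed
action of the relaxed action set in hindsight, minus the expected total reward of the policy. -/
noncomputable def expectedVirtualRegret {n m d N : ℕ} (G : Network n m d) (C : ℕ)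
    (x : ℕ → UserVec n N) {Ω : Type*} [MeasurableSpace Ω] (P : Measure Ω)
    (a : ℕ → Ω → UserVec n N × CacheVec m N) (T : ℕ) : ℝ :=
  sSup ((fun b : UserVec n N × CacheVec m N =>
      ∑ t ∈ Finset.Icc 1 T, virtualReward (x t) b.1) '' Zrel G N C)
    - ∫ ω, ∑ t ∈ Finset.Icc 1 T, virtualReward (x t) (a t ω).1 ∂P

/-- The expected regret up to time `T` for the physical rewards (cache hits) of the fractional
physical configurations, against the best fixed fractional physical configuration. -/
noncomputable def expectedPhysicalRegret {n m d N : ℕ} (G : Network n m d) (C : ℕ)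
    (x : ℕ → UserVec n N) {Ω : Type*} [MeasurableSpace Ω] (P : Measure Ω)
    (a : ℕ → Ω → UserVec n N × CacheVec m N) (T : ℕ) : ℝ :=
  sSup ((fun y : CacheVec m N =>
      ∑ t ∈ Finset.Icc 1 T, physicalReward G (x t) y) '' Yrel m N C)
    - ∫ ω, ∑ t ∈ Finset.Icc 1 T, physicalReward G (x t) (a t ω).2 ∂P

end LeadCache

/-! Let `h` be the support function of the virtual actions and let Φ_c(X) be the expectation of h(X
+ cγ). An action optimal for θ earns at least h(θ) − h(θ − x) on the request x
(`supportFn_sub_le_reward`), so the expected reward in slot t is at least the backward difference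
Φ_{η_t}(X_t) − Φ_{η_t}(X_t − x_t). The best fixed action earns h(X_{T+1}) ≤ Φ_{η_T}(X_{T+1}) by
Jensen. Writing this last value as a telescoping sum of potentials leaves two losses.

The first is replacing forward differences by backward ones (`perturbedValue_second_diff_le`). The
backward difference is the mean of a function of γ with values in [0, n], and the forward difference
is the mean of the same function translated by x_t/η_t, a vector of norm at most √n/η_t. By
Cameron–Martin and a chi-square estimate the mean moves by at most 2n√n/η_t
(`integral_comp_add_stdGauss_sub_le`). No derivative of Φ is needed.

The second is the growth of the noise, which costs η_T times the Gaussian width of the action set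
(`perturbedValue_le_of_le`). Since virtual actions have total mass at most A = dmC, the width is at
most A(ln(Nn) + 2).

With η_t = β√t the losses are of order n^{3/2}√T/β and βA√T ln(Nn), balanced by β = n^{3/4}/√A. The
cache-hit regret never exceeds the virtual one. -/

namespace LeadCache

/-! ### Translations of the standard Gaussian measure -/

section GaussianShift

variable {ι : Type*} [Fintype ι]

/-- The standard Gaussian measure on `ι → ℝ`. -/
noncomputable abbrev stdGauss (ι : Type*) [Fintype ι] : Measure (ι → ℝ) :=
  Measure.pi fun _ : ι => gaussianReal 0 1

/-- The density of the standard Gaussian measure translated by `v`, relative to the untranslated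
one. -/
noncomputable def shiftDensity (v γ : ι → ℝ) : ℝ :=
  ∏ p, Real.exp (v p * γ p - v p ^ 2 / 2)

lemma shiftDensity_nonneg (v γ : ι → ℝ) : 0 ≤ shiftDensity v γ :=
  Finset.prod_nonneg fun _ _ => (Real.exp_pos _).le

lemma measurable_shiftDensity (v : ι → ℝ) : Measurable (shiftDensity v) := by
  unfold shiftDensity; fun_prop

lemma integrable_exp_affine_gaussianReal (a b : ℝ) :
    Integrable (fun y => Real.exp (a * y - b)) (gaussianReal 0 1) := by
  simpa [Real.exp_sub, div_eq_mul_inv] using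
    (integrable_exp_mul_gaussianReal (μ := 0) (v := 1) a).mul_const (Real.exp b)⁻¹

lemma integral_exp_affine_gaussianReal (a b : ℝ) :
    ∫ y, Real.exp (a * y - b) ∂(gaussianReal 0 1) = Real.exp (a ^ 2 / 2 - b) := by
  have h := congrFun (mgf_id_gaussianReal (μ := 0) (v := 1)) a
  simp only [mgf, id, zero_mul, zero_add, NNReal.coe_one, one_mul] at h
  simp only [Real.exp_sub, integral_div, h]

lemma gaussianReal_eq_withDensity_shift (a : ℝ) :
    gaussianReal a 1 = (gaussianReal 0 1).withDensity
      fun y => ENNReal.ofReal (Real.exp (a * y - a ^ 2 / 2)) := by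
  rw [gaussianReal_of_var_ne_zero _ one_ne_zero, gaussianReal_of_var_ne_zero _ one_ne_zero,
    ← withDensity_mul _ (measurable_gaussianPDF _ _) (by fun_prop)]
  congr 1
  ext y
  simp only [Pi.mul_apply, gaussianPDF, gaussianPDFReal]
  rw [← ENNReal.ofReal_mul (by positivity), mul_assoc (_⁻¹), ← Real.exp_add]
  congr 3
  simp
  ring

lemma pi_gaussianReal_eq_withDensity (v : ι → ℝ) :
    Measure.pi (fun p => gaussianReal (v p) 1) =
      (stdGauss ι).withDensity fun γ => ENNReal.ofReal (shiftDensity v γ) := by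
  refine (Measure.pi_eq fun s hs => ?_)
  have hint : ∀ p, Integrable (fun y => Real.exp (v p * y - v p ^ 2 / 2))
      ((gaussianReal 0 1).restrict (s p)) :=
    fun p => (integrable_exp_affine_gaussianReal _ _).restrict
  rw [withDensity_apply _ (MeasurableSet.univ_pi hs), Measure.restrict_pi_pi,
    ← ofReal_integral_eq_lintegral_ofReal]
  · simp only [shiftDensity]
    rw [integral_fintype_prod_eq_prod (fun p y => Real.exp (v p * y - v p ^ 2 / 2)),
      ENNReal.ofReal_prod_of_nonneg fun p _ => integral_nonneg fun y => (Real.exp_pos _).le]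
    refine Finset.prod_congr rfl fun p _ => ?_
    rw [gaussianReal_eq_withDensity_shift (v p), withDensity_apply _ (hs p),
      ofReal_integral_eq_lintegral_ofReal (hint p) (ae_of_all _ fun y => (Real.exp_pos _).le)]
  · exact Integrable.fintype_prod hint
  · exact ae_of_all _ fun γ => shiftDensity_nonneg v γ

/-- The Cameron–Martin formula in finite dimension, obtained one coordinate at a time. -/
lemma map_add_stdGauss (v : ι → ℝ) :
    (stdGauss ι).map (fun γ => γ + v) =
      (stdGauss ι).withDensity fun γ => ENNReal.ofReal (shiftDensity v γ) := by
  rw [← pi_gaussianReal_eq_withDensity]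
  have h := Measure.pi_map_pi (μ := fun _ : ι => gaussianReal 0 1) (f := fun p y => y + v p)
    fun p => by fun_prop
  simp only [gaussianReal_map_add_const, zero_add] at h
  exact h

lemma integral_comp_add_stdGauss (v : ι → ℝ) {F : (ι → ℝ) → ℝ} (hF : Measurable F) :
    ∫ γ, F (γ + v) ∂(stdGauss ι) = ∫ γ, shiftDensity v γ * F γ ∂(stdGauss ι) := by
  rw [← integral_map (φ := fun γ => γ + v) (by fun_prop) hF.aestronglyMeasurable, map_add_stdGauss,
    integral_withDensity_eq_integral_toReal_smul (measurable_shiftDensity v).ennreal_ofReal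
      (by simp)]
  simp [ENNReal.toReal_ofReal (shiftDensity_nonneg v _)]

lemma integrable_shiftDensity (v : ι → ℝ) : Integrable (shiftDensity v) (stdGauss ι) :=
  Integrable.fintype_prod fun _ => integrable_exp_affine_gaussianReal _ _

lemma integral_shiftDensity (v : ι → ℝ) : ∫ γ, shiftDensity v γ ∂(stdGauss ι) = 1 := by
  simp only [shiftDensity]
  rw [integral_fintype_prod_eq_prod (fun p y => Real.exp (v p * y - v p ^ 2 / 2))]
  simp [integral_exp_affine_gaussianReal]

lemma shiftDensity_sq (v γ : ι → ℝ) :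
    shiftDensity v γ ^ 2 = ∏ p, Real.exp ((2 * v p) * γ p - v p ^ 2) := by
  rw [shiftDensity, ← Finset.prod_pow]
  refine Finset.prod_congr rfl fun p _ => ?_
  rw [← Real.exp_nat_mul]
  congr 1
  push_cast
  ring

lemma integrable_shiftDensity_sq (v : ι → ℝ) :
    Integrable (fun γ => shiftDensity v γ ^ 2) (stdGauss ι) := by
  simp only [shiftDensity_sq]
  exact Integrable.fintype_prod (f := fun p y => Real.exp ((2 * v p) * y - v p ^ 2))
    fun p => integrable_exp_affine_gaussianReal _ _

/-- As the density has mean one, its variance is exp(‖v‖²) − 1: the chi-square divergence that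
controls the effect of a translation. -/
lemma integral_shiftDensity_sq (v : ι → ℝ) :
    ∫ γ, shiftDensity v γ ^ 2 ∂(stdGauss ι) = Real.exp (∑ p, v p ^ 2) := by
  simp only [shiftDensity_sq]
  rw [integral_fintype_prod_eq_prod (fun p y => Real.exp ((2 * v p) * y - v p ^ 2)),
    Real.exp_sum]
  refine Finset.prod_congr rfl fun p _ => ?_
  rw [integral_exp_affine_gaussianReal]
  congr 1
  ring

/-- Translating a standard Gaussian vector by `v` changes the expectation of a function with values
in `[0, B]` by at most `2 B ‖v‖`. -/
lemma integral_comp_add_stdGauss_sub_le (v : ι → ℝ) {F : (ι → ℝ) → ℝ} (hF : Measurable F)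
    {B s : ℝ} (hF0 : ∀ γ, 0 ≤ F γ) (hFB : ∀ γ, F γ ≤ B) (hs : 0 ≤ s) (hv : ∑ p, v p ^ 2 ≤ s ^ 2) :
    ∫ γ, F (γ + v) ∂(stdGauss ι) - ∫ γ, F γ ∂(stdGauss ι) ≤ 2 * B * s := by
  have hB : 0 ≤ B := (hF0 0).trans (hFB 0)
  have hFi : Integrable F (stdGauss ι) :=
    .of_bound hF.aestronglyMeasurable B (ae_of_all _ fun γ => by
      rw [Real.norm_of_nonneg (hF0 γ)]; exact hFB γ)
  -- The argument below divides by `s`, so the zero translation is treated apart.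
  rcases hs.eq_or_lt with rfl | hs0
  · have hv0 : v = 0 := by
      ext p
      have h1 := (Finset.single_le_sum (f := fun p => v p ^ 2) (fun q _ => sq_nonneg (v q))
        (Finset.mem_univ p)).trans hv
      simpa using le_antisymm (h1.trans_eq (by simp)) (sq_nonneg (v p))
    simp [hv0]
  rcases le_or_gt s 1 with hs1 | hs1
  · rw [integral_comp_add_stdGauss v hF]
    have hDF : Integrable (fun γ => shiftDensity v γ * F γ) (stdGauss ι) :=
      (integrable_shiftDensity v).mul_bdd (c := B) hF.aestronglyMeasurable
        (ae_of_all _ fun γ => by rw [Real.norm_of_nonneg (hF0 γ)]; exact hFB γ)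
    rw [← integral_sub hDF hFi]
    have hlin : Integrable (fun γ => shiftDensity v γ ^ 2 - 2 * shiftDensity v γ) (stdGauss ι) :=
      (integrable_shiftDensity_sq v).sub ((integrable_shiftDensity v).const_mul 2)
    have hsq : Integrable (fun γ => (shiftDensity v γ - 1) ^ 2) (stdGauss ι) := by
      refine (hlin.add (integrable_const (1 : ℝ))).congr (ae_of_all _ fun γ => ?_)
      simp only [Pi.add_apply]
      ring
    have hsqi : ∫ γ, (shiftDensity v γ - 1) ^ 2 ∂(stdGauss ι) = Real.exp (∑ p, v p ^ 2) - 1 := by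
      have h1 : (fun γ => (shiftDensity v γ - 1) ^ 2) =
          fun γ => (shiftDensity v γ ^ 2 - 2 * shiftDensity v γ) + 1 := by ext γ; ring
      rw [h1, integral_add hlin (integrable_const _),
        integral_sub (integrable_shiftDensity_sq v) ((integrable_shiftDensity v).const_mul 2),
        integral_const_mul, integral_shiftDensity, integral_shiftDensity_sq]
      simp
      ring
    have hexp : Real.exp (∑ p, v p ^ 2) - 1 ≤ 2 * s ^ 2 := by
      have h1 : s ^ 2 ≤ 1 := by nlinarith
      have h2 := Real.exp_le_exp.2 hv
      have h3 := Real.abs_exp_sub_one_le (x := s ^ 2) (by rw [abs_of_nonneg (by positivity)]; exact h1)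
      rw [abs_of_nonneg (by positivity : (0 : ℝ) ≤ s ^ 2)] at h3
      linarith [le_abs_self (Real.exp (s ^ 2) - 1)]
    -- A weighted AM–GM inequality takes the place of Cauchy–Schwarz; the weight `s` matches the
    -- standard deviation of the density, which is at most √2 · `s` here.
    have hpt : ∀ γ, shiftDensity v γ * F γ - F γ ≤
        B / (2 * s) * (shiftDensity v γ - 1) ^ 2 + B * s / 2 := by
      intro γ
      have h1 : shiftDensity v γ - 1 ≤ (shiftDensity v γ - 1) ^ 2 / (2 * s) + s / 2 := by
        rw [div_add_div _ _ (by positivity) (by positivity), le_div_iff₀ (by positivity)]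
        nlinarith [sq_nonneg (shiftDensity v γ - 1 - s)]
      have h2 : 0 ≤ (shiftDensity v γ - 1) ^ 2 / (2 * s) + s / 2 := by positivity
      calc shiftDensity v γ * F γ - F γ = (shiftDensity v γ - 1) * F γ := by ring
        _ ≤ ((shiftDensity v γ - 1) ^ 2 / (2 * s) + s / 2) * F γ :=
          mul_le_mul_of_nonneg_right h1 (hF0 γ)
        _ ≤ ((shiftDensity v γ - 1) ^ 2 / (2 * s) + s / 2) * B :=
          mul_le_mul_of_nonneg_left (hFB γ) h2
        _ = _ := by ring
    calc _ ≤ ∫ γ, B / (2 * s) * (shiftDensity v γ - 1) ^ 2 + B * s / 2 ∂(stdGauss ι) :=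
          integral_mono (hDF.sub hFi) ((hsq.const_mul _).add (integrable_const _)) hpt
      _ = B / (2 * s) * (Real.exp (∑ p, v p ^ 2) - 1) + B * s / 2 := by
          rw [integral_add (hsq.const_mul _) (integrable_const _), integral_const_mul, hsqi]
          simp
      _ ≤ B / (2 * s) * (2 * s ^ 2) + B * s / 2 := by gcongr
      _ = 3 / 2 * (B * s) := by field_simp; ring
      _ ≤ 2 * B * s := by nlinarith [mul_nonneg hB hs]
  -- For `s > 1` the trivial bound `B` on the difference suffices.
  · have h1 : ∫ γ, F (γ + v) ∂(stdGauss ι) ≤ B := by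
      have := integral_mono_of_nonneg (μ := stdGauss ι) (ae_of_all _ fun γ => hF0 (γ + v))
        (integrable_const B) (ae_of_all _ fun γ => hFB (γ + v))
      simpa using this
    have h2 : 0 ≤ ∫ γ, F γ ∂(stdGauss ι) := integral_nonneg hF0
    nlinarith

lemma integrable_eval_stdGauss (f : ℝ → ℝ) (hf : Integrable f (gaussianReal 0 1)) (p : ι) :
    Integrable (fun γ => f (γ p)) (stdGauss ι) :=
  integrable_comp_eval (μ := fun _ : ι => gaussianReal 0 1) (i := p) hf

lemma integral_eval_stdGauss (f : ℝ → ℝ) (hf : Measurable f) (p : ι) :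
    ∫ γ, f (γ p) ∂(stdGauss ι) = ∫ y, f y ∂(gaussianReal 0 1) :=
  integral_comp_eval (μ := fun _ : ι => gaussianReal 0 1) (i := p) hf.aestronglyMeasurable

end GaussianShift

/-! ### Support functions, their Gaussian smoothing and the perturbed-leader potential -/

section SupportFunction

variable {ι : Type*} [Fintype ι]

/-- The support function of a set of actions: the value of the linear program with objective
`θ`. -/
noncomputable def supportFn (S : Set (ι → ℝ)) (θ : ι → ℝ) : ℝ :=
  sSup ((fun z => ∑ p, θ p * z p) '' S)

/-- A nonempty set of vectors of the unit cube with `ℓ¹`-norms at most `A`. -/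
structure IsActionSet (S : Set (ι → ℝ)) (A : ℝ) : Prop where
  nonempty : S.Nonempty
  nonneg : ∀ z ∈ S, ∀ p, 0 ≤ z p
  le_one : ∀ z ∈ S, ∀ p, z p ≤ 1
  sum_le : ∀ z ∈ S, ∑ p, z p ≤ A

variable {S : Set (ι → ℝ)} {A : ℝ}

namespace IsActionSet

lemma sum_mul_le (hS : IsActionSet S A) (θ : ι → ℝ) {z : ι → ℝ} (hz : z ∈ S) :
    ∑ p, θ p * z p ≤ ∑ p, |θ p| :=
  Finset.sum_le_sum fun p _ => by
    have h0 := hS.nonneg z hz p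
    have h1 := hS.le_one z hz p
    nlinarith [le_abs_self (θ p), abs_nonneg (θ p), mul_le_mul_of_nonneg_right (le_abs_self (θ p)) h0]

lemma le_supportFn (hS : IsActionSet S A) (θ : ι → ℝ) {z : ι → ℝ} (hz : z ∈ S) :
    ∑ p, θ p * z p ≤ supportFn S θ :=
  le_csSup ⟨∑ p, |θ p|, by rintro _ ⟨w, hw, rfl⟩; exact hS.sum_mul_le θ hw⟩ ⟨z, hz, rfl⟩

lemma supportFn_le (hS : IsActionSet S A) {θ : ι → ℝ} {c : ℝ}
    (h : ∀ z ∈ S, ∑ p, θ p * z p ≤ c) : supportFn S θ ≤ c :=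
  csSup_le (hS.nonempty.image _) (by rintro _ ⟨w, hw, rfl⟩; exact h w hw)

lemma supportFn_zero (hS : IsActionSet S A) : supportFn S 0 = 0 := by
  obtain ⟨z, hz⟩ := hS.nonempty
  refine le_antisymm (hS.supportFn_le fun z _ => by simp) ?_
  simpa using hS.le_supportFn 0 hz

lemma bound_nonneg (hS : IsActionSet S A) : 0 ≤ A := by
  obtain ⟨z, hz⟩ := hS.nonempty
  exact (Finset.sum_nonneg fun p _ => hS.nonneg z hz p).trans (hS.sum_le z hz)

lemma supportFn_add_le (hS : IsActionSet S A) (θ θ' : ι → ℝ) :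
    supportFn S (θ + θ') ≤ supportFn S θ + supportFn S θ' := by
  refine hS.supportFn_le fun z hz => ?_
  simp only [Pi.add_apply, add_mul, Finset.sum_add_distrib]
  exact add_le_add (hS.le_supportFn θ hz) (hS.le_supportFn θ' hz)

lemma supportFn_smul_le (hS : IsActionSet S A) {c : ℝ} (hc : 0 ≤ c) (θ : ι → ℝ) :
    supportFn S (c • θ) ≤ c * supportFn S θ := by
  refine hS.supportFn_le fun z hz => ?_
  simp only [Pi.smul_apply, smul_eq_mul, mul_assoc, ← Finset.mul_sum]
  exact mul_le_mul_of_nonneg_left (hS.le_supportFn θ hz) hc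

lemma supportFn_le_sum_abs (hS : IsActionSet S A) (θ : ι → ℝ) : supportFn S θ ≤ ∑ p, |θ p| :=
  hS.supportFn_le fun _ hz => hS.sum_mul_le θ hz

lemma supportFn_sub_le (hS : IsActionSet S A) (θ θ' : ι → ℝ) :
    supportFn S θ - supportFn S θ' ≤ ∑ p, |θ p - θ' p| := by
  have h1 := hS.supportFn_add_le θ' (θ - θ')
  have h2 := hS.supportFn_le_sum_abs (θ - θ')
  rw [add_sub_cancel] at h1
  simp only [Pi.sub_apply] at h2
  linarith

lemma abs_supportFn_le (hS : IsActionSet S A) (θ : ι → ℝ) : |supportFn S θ| ≤ ∑ p, |θ p| := by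
  have h1 := hS.supportFn_sub_le θ 0
  have h2 := hS.supportFn_sub_le 0 θ
  simp only [hS.supportFn_zero, Pi.zero_apply, sub_zero, zero_sub, abs_neg] at h1 h2
  exact abs_le.2 ⟨by linarith, h1⟩

/-- Actions have nonnegative coordinates, so the support function is monotone in the objective. -/
lemma supportFn_sub_nonneg (hS : IsActionSet S A) (θ : ι → ℝ) {x : ι → ℝ} (hx : ∀ p, 0 ≤ x p) :
    0 ≤ supportFn S θ - supportFn S (θ - x) := by
  refine sub_nonneg.2 (hS.supportFn_le fun z hz => le_trans ?_ (hS.le_supportFn θ hz))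
  refine Finset.sum_le_sum fun p _ => mul_le_mul_of_nonneg_right ?_ (hS.nonneg z hz p)
  simpa using hx p

lemma continuous_supportFn (hS : IsActionSet S A) : Continuous (supportFn S) := by
  have h : LipschitzWith (Fintype.card ι) (supportFn S) := by
    refine LipschitzWith.of_le_add_mul _ fun θ θ' => ?_
    have h1 := hS.supportFn_sub_le θ θ'
    have h2 : ∑ p, |θ p - θ' p| ≤ ∑ _p : ι, dist θ θ' :=
      Finset.sum_le_sum fun p _ => by
        rw [← Real.dist_eq]; exact dist_le_pi_dist θ θ' p
    simp only [Finset.sum_const, Finset.card_univ, nsmul_eq_mul] at h2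
    simp only [NNReal.coe_natCast]
    linarith
  exact h.continuous

lemma integrable_supportFn (hS : IsActionSet S A) (X : ι → ℝ) (c : ℝ) :
    Integrable (fun γ => supportFn S (X + c • γ)) (stdGauss ι) := by
  have hm : Continuous fun γ : ι → ℝ => supportFn S (X + c • γ) :=
    hS.continuous_supportFn.comp (by fun_prop)
  have hid : Integrable (fun y : ℝ => y) (gaussianReal 0 1) :=
    (memLp_id_gaussianReal 1).integrable le_rfl
  have hb : Integrable (fun γ : ι → ℝ => ∑ p, (|X p| + |c| * |γ p|)) (stdGauss ι) :=
    integrable_finsetSum _ fun p _ => (integrable_const _).add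
      ((integrable_eval_stdGauss (fun y => |y|) hid.abs p).const_mul _)
  refine hb.mono' hm.aestronglyMeasurable (ae_of_all _ fun γ => ?_)
  refine (hS.abs_supportFn_le _).trans (Finset.sum_le_sum fun p _ => ?_)
  simpa [abs_mul] using abs_add_le (X p) (c * γ p)

end IsActionSet

/-- The expected value of the linear program whose objective `X` is perturbed by Gaussian noise of
standard deviation `c`. -/
noncomputable def perturbedValue (S : Set (ι → ℝ)) (X : ι → ℝ) (c : ℝ) : ℝ :=
  ∫ γ, supportFn S (X + c • γ) ∂(stdGauss ι)

namespace IsActionSet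

/-- Jensen's inequality: the noise is centred, so each fixed action has the same expected value
under the perturbed objective as under `X`. -/
lemma supportFn_le_perturbedValue (hS : IsActionSet S A) (X : ι → ℝ) (c : ℝ) :
    supportFn S X ≤ perturbedValue S X c := by
  refine hS.supportFn_le fun z hz => ?_
  have hid : Integrable (fun y : ℝ => y) (gaussianReal 0 1) :=
    (memLp_id_gaussianReal 1).integrable le_rfl
  have hγ : ∀ p, Integrable (fun γ : ι → ℝ => γ p) (stdGauss ι) :=
    fun p => integrable_eval_stdGauss (fun y => y) hid p
  have hi : ∀ p, Integrable (fun γ : ι → ℝ => (X + c • γ) p * z p) (stdGauss ι) :=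
    fun p => ((integrable_const _).add ((hγ p).const_mul c)).mul_const _
  have h : ∫ γ, ∑ p, (X + c • γ) p * z p ∂(stdGauss ι) = ∑ p, X p * z p := by
    rw [integral_finsetSum _ fun p _ => hi p]
    refine Finset.sum_congr rfl fun p _ => ?_
    simp only [Pi.add_apply, Pi.smul_apply, smul_eq_mul]
    rw [integral_mul_const, integral_add (integrable_const _) ((hγ p).const_mul c),
      integral_const_mul, integral_eval_stdGauss (fun y => y) measurable_id,
      integral_id_gaussianReal]
    simp
  rw [← h]
  exact integral_mono (integrable_finsetSum _ fun p _ => hi p) (hS.integrable_supportFn X c)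
    fun γ => hS.le_supportFn _ hz

/-- Both noise levels are coupled through the same `γ`, and subadditivity splits off the increment.
Summed over the slots, these costs telescope. -/
lemma perturbedValue_le_of_le (hS : IsActionSet S A) (X : ι → ℝ) {c c' : ℝ} (hc : c ≤ c') :
    perturbedValue S X c' ≤ perturbedValue S X c + (c' - c) * perturbedValue S 0 1 := by
  have h1 := hS.integrable_supportFn X c
  have h2 := hS.integrable_supportFn 0 1
  rw [perturbedValue, perturbedValue, perturbedValue, ← integral_const_mul,
    ← integral_add h1 (h2.const_mul _)]
  refine integral_mono (hS.integrable_supportFn X c') (h1.add (h2.const_mul _)) fun γ => ?_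
  have h3 : X + c' • γ = (X + c • γ) + (c' - c) • γ := by rw [sub_smul]; abel
  simp only [zero_add, one_smul]
  rw [h3]
  exact (hS.supportFn_add_le _ _).trans (by gcongr; exact hS.supportFn_smul_le (by linarith) _)

lemma perturbedValue_zero_zero (hS : IsActionSet S A) : perturbedValue S 0 0 = 0 := by
  simp [perturbedValue, hS.supportFn_zero]

/-- The Gaussian width of a set of actions of `ℓ¹`-norm at most `A` is at most logarithmic in the
dimension. -/
lemma perturbedValue_zero_one_le [Nonempty ι] (hS : IsActionSet S A) :
    perturbedValue S 0 1 ≤ A * (Real.log (Fintype.card ι) + 2) := by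
  set L : ℝ := ((Fintype.card ι : ℕ) : ℝ) with hL
  have hL1 : 1 ≤ L := Nat.one_le_cast.2 Fintype.card_pos
  have hL0 : 0 < L := by linarith
  have hA := hS.bound_nonneg
  have hlog : 0 ≤ Real.log L := Real.log_nonneg hL1
  have hexp : Integrable (fun y : ℝ => Real.exp y) (gaussianReal 0 1) := by
    simpa using integrable_exp_affine_gaussianReal 1 0
  -- The integral is √e, and e < 4.
  have hexpi : ∫ y, Real.exp y ∂(gaussianReal 0 1) ≤ 2 := by
    have h := integral_exp_affine_gaussianReal 1 0
    simp only [one_mul, sub_zero, one_pow] at h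
    rw [h]
    have h1 : Real.exp (1 / 2) ^ 2 = Real.exp 1 := by
      rw [← Real.exp_nat_mul]; norm_num
    nlinarith [Real.exp_one_lt_d9, Real.exp_pos (1 / 2)]
  have hi : ∀ p, Integrable (fun γ : ι → ℝ => Real.exp (γ p)) (stdGauss ι) :=
    fun p => integrable_eval_stdGauss (fun y => Real.exp y) hexp p
  have hsum : Integrable (fun γ : ι → ℝ => ∑ p, Real.exp (γ p)) (stdGauss ι) :=
    integrable_finsetSum _ fun p _ => hi p
  have hpt : ∀ γ : ι → ℝ, supportFn S ((0 : ι → ℝ) + (1 : ℝ) • γ) ≤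
      A * Real.log L + A / L * ∑ p, Real.exp (γ p) := by
    intro γ
    rw [zero_add, one_smul]
    refine hS.supportFn_le fun z hz => ?_
    have hz0 := hS.nonneg z hz
    have hzA : ∀ p, z p ≤ A := fun p =>
      (Finset.single_le_sum (fun q _ => hz0 q) (Finset.mem_univ p)).trans (hS.sum_le z hz)
    -- The exponential lies above its tangent at `log L`. This point of tangency makes the `L`
    -- exponential terms contribute only a constant multiple of `A` after averaging.
    have hγ : ∀ p, γ p ≤ Real.log L + Real.exp (γ p) / L := by
      intro p
      have h := Real.add_one_le_exp (γ p - Real.log L)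
      rw [Real.exp_sub, Real.exp_log hL0] at h
      linarith
    calc ∑ p, γ p * z p ≤ ∑ p, (Real.log L * z p + A / L * Real.exp (γ p)) := by
          refine Finset.sum_le_sum fun p _ => ?_
          calc γ p * z p ≤ (Real.log L + Real.exp (γ p) / L) * z p :=
                mul_le_mul_of_nonneg_right (hγ p) (hz0 p)
            _ = Real.log L * z p + Real.exp (γ p) / L * z p := by ring
            _ ≤ Real.log L * z p + Real.exp (γ p) / L * A := by
                gcongr; exact hzA p
            _ = _ := by ring
      _ = Real.log L * ∑ p, z p + A / L * ∑ p, Real.exp (γ p) := by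
          rw [Finset.sum_add_distrib, Finset.mul_sum, Finset.mul_sum]
      _ ≤ Real.log L * A + A / L * ∑ p, Real.exp (γ p) := by
          gcongr; exact hS.sum_le z hz
      _ = _ := by ring
  calc perturbedValue S 0 1
      ≤ ∫ γ, (A * Real.log L + A / L * ∑ p, Real.exp (γ p)) ∂(stdGauss ι) :=
        integral_mono (hS.integrable_supportFn 0 1) ((integrable_const _).add (hsum.const_mul _)) hpt
    _ = A * Real.log L + A / L * ∑ _p : ι, ∫ y, Real.exp y ∂(gaussianReal 0 1) := by
        rw [integral_add (integrable_const _) (hsum.const_mul _), integral_const_mul (A / L),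
          integral_finsetSum _ fun p _ => hi p]
        simp only [integral_eval_stdGauss (fun y => Real.exp y) Real.measurable_exp]
        simp
    _ ≤ A * Real.log L + A / L * ∑ _p : ι, 2 := by gcongr
    _ = A * (Real.log L + 2) := by
        simp only [Finset.sum_const, Finset.card_univ, nsmul_eq_mul, ← hL]
        field_simp

/-- The decrease of the value when the request `x` is removed from the objective `θ` is a lower
bound for the reward of an action that is optimal for `θ`. -/
lemma supportFn_sub_le_reward (hS : IsActionSet S A) {θ : ι → ℝ} (x : ι → ℝ) {z : ι → ℝ}
    (hz : z ∈ S) (hmax : supportFn S θ ≤ ∑ p, θ p * z p) :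
    supportFn S θ - supportFn S (θ - x) ≤ ∑ p, x p * z p := by
  have h := hS.le_supportFn (θ - x) hz
  simp only [Pi.sub_apply, sub_mul, Finset.sum_sub_distrib] at h
  linarith

/-- The second difference of the perturbed value in the direction of a vector of the unit cube
with `ℓ¹`-norm at most `B`. -/
lemma perturbedValue_second_diff_le (hS : IsActionSet S A) (X x : ι → ℝ) {c B : ℝ} (hc : 0 < c)
    (hx0 : ∀ p, 0 ≤ x p) (hx1 : ∀ p, x p ≤ 1) (hxB : ∑ p, x p ≤ B) :
    perturbedValue S (X + x) c - perturbedValue S X c ≤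
      (perturbedValue S X c - perturbedValue S (X - x) c) + 2 * B * (√B / c) := by
  have hB : 0 ≤ B := (Finset.sum_nonneg fun p _ => hx0 p).trans hxB
  set F : (ι → ℝ) → ℝ := fun γ => supportFn S (X + c • γ) - supportFn S (X - x + c • γ) with hFdef
  have hF : Measurable F :=
    ((hS.continuous_supportFn.comp (by fun_prop)).sub
      (hS.continuous_supportFn.comp (by fun_prop))).measurable
  have hF0 : ∀ γ, 0 ≤ F γ := fun γ => by
    have := hS.supportFn_sub_nonneg (X + c • γ) hx0
    rwa [add_sub_right_comm] at this
  have hFB : ∀ γ, F γ ≤ B := fun γ => by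
    have := hS.supportFn_sub_le (X + c • γ) (X - x + c • γ)
    refine this.trans (le_trans (le_of_eq (Finset.sum_congr rfl fun p _ => ?_)) hxB)
    have h : (X + c • γ) p - (X - x + c • γ) p = x p := by
      simp only [Pi.add_apply, Pi.sub_apply]; ring
    rw [h, abs_of_nonneg (hx0 p)]
  -- On the unit cube x² ≤ x, so the `ℓ¹` bound also bounds the squared Euclidean norm.
  have hv : ∑ p, (c⁻¹ • x) p ^ 2 ≤ (√B / c) ^ 2 := by
    rw [div_pow, Real.sq_sqrt hB, div_eq_inv_mul, ← inv_pow]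
    simp only [Pi.smul_apply, smul_eq_mul, mul_pow, ← Finset.mul_sum]
    gcongr
    exact (Finset.sum_le_sum fun p _ => by nlinarith [hx0 p, hx1 p]).trans hxB
  have key := integral_comp_add_stdGauss_sub_le (c⁻¹ • x) hF hF0 hFB (by positivity) hv
  -- Moving the noise by x/c moves the objective by x, which turns the backward difference into the
  -- forward one.
  have hshift : ∀ γ, F (γ + c⁻¹ • x) = supportFn S (X + x + c • γ) - supportFn S (X + c • γ) := by
    intro γ
    simp only [hFdef, smul_add, smul_inv_smul₀ hc.ne']
    congr 2 <;> abel
  simp only [hshift] at key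
  rw [integral_sub (hS.integrable_supportFn _ _) (hS.integrable_supportFn _ _), hFdef,
    integral_sub (hS.integrable_supportFn _ _) (hS.integrable_supportFn _ _)] at key
  simp only [perturbedValue]
  linarith

/-- The regret of follow-the-perturbed-leader in terms of one-step differences of the perturbed
value. -/
lemma perturbedValue_sum_le (hS : IsActionSet S A) {X x : ℕ → ι → ℝ} {c : ℕ → ℝ} {B : ℝ}
    (hX0 : X 1 = 0) (hX : ∀ t, 1 ≤ t → X (t + 1) = X t + x t)
    (hc0 : c 0 = 0) (hc : Monotone c) (hcpos : ∀ t, 1 ≤ t → 0 < c t)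
    (hx0 : ∀ t p, 0 ≤ x t p) (hx1 : ∀ t p, x t p ≤ 1) (hxB : ∀ t, ∑ p, x t p ≤ B) (T : ℕ) :
    perturbedValue S (X (T + 1)) (c T) ≤
      ∑ t ∈ Finset.Icc 1 T, (perturbedValue S (X t) (c t) - perturbedValue S (X t - x t) (c t)) +
        c T * perturbedValue S 0 1 + ∑ t ∈ Finset.Icc 1 T, 2 * B * (√B / c t) := by
  induction T with
  -- Starting from noise level `c 0 = 0` makes the initial potential vanish; the first increment `c
  -- 1 - c 0` then pays for all the noise of slot 1.
  | zero => simp [hX0, hc0, hS.perturbedValue_zero_zero]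
  | succ T ih =>
    rw [Finset.sum_Icc_succ_top (by omega), Finset.sum_Icc_succ_top (by omega)]
    have h1 := hS.perturbedValue_second_diff_le (X (T + 1)) (x (T + 1)) (hcpos (T + 1) (by omega))
      (hx0 _) (hx1 _) (hxB _)
    have h2 := hS.perturbedValue_le_of_le (X (T + 1)) (hc (Nat.le_succ T))
    rw [← hX (T + 1) (by omega)] at h1
    simp only [Nat.succ_eq_add_one] at h2
    linarith

end IsActionSet

end SupportFunction

/-! ### Virtual and physical configurations of the network -/

section Caching

variable {n m d N C : ℕ}

/-- The virtual configurations of the relaxed action set. -/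
def virtualActions (G : Network n m d) (N C : ℕ) : Set (UserVec n N) :=
  Prod.fst '' Zrel G N C

lemma zero_mem_Zrel (G : Network n m d) (N C : ℕ) : (0 : UserVec n N × CacheVec m N) ∈ Zrel G N C := by
  refine ⟨⟨fun p => by simp, fun j => by simp⟩, fun p => by simp, fun i f => by simp⟩

/-- Double counting along the edges: each cache serves at most `d` users and offers each of them a
total of at most `C`. -/
lemma sum_le_of_mem_Zrel (G : Network n m d) {b : UserVec n N × CacheVec m N}
    (hb : b ∈ Zrel G N C) : ∑ p, b.1 p ≤ (d : ℝ) * m * C := by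
  obtain ⟨⟨hy, hC⟩, -, hzy⟩ := hb
  calc ∑ p, b.1 p = ∑ i : Fin n, ∑ f : Fin N, b.1 (i, f) := Fintype.sum_prod_type _
    _ ≤ ∑ i : Fin n, ∑ f : Fin N, ∑ j : Fin m, if (i, j) ∈ G.edges then b.2 (j, f) else 0 := by
        gcongr with i _ f _
        refine (hzy i f).trans_eq ?_
        rw [Network.cachesOf, Finset.sum_filter]
    _ = ∑ j : Fin m, ∑ i : Fin n, if (i, j) ∈ G.edges then ∑ f : Fin N, b.2 (j, f) else 0 := by
        rw [Finset.sum_comm]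
        simp_rw [Finset.sum_comm (s := (Finset.univ : Finset (Fin n)))]
        rw [Finset.sum_comm]
        refine Finset.sum_congr rfl fun j _ => ?_
        rw [Finset.sum_comm]
        refine Finset.sum_congr rfl fun i _ => ?_
        split_ifs <;> simp
    _ ≤ ∑ _j : Fin m, (d : ℝ) * C := by
        refine Finset.sum_le_sum fun j _ => ?_
        rw [← Finset.sum_filter, Finset.sum_const, nsmul_eq_mul]
        have h1 : ((Finset.univ.filter fun i : Fin n => (i, j) ∈ G.edges).card : ℝ) ≤ d := by
          exact_mod_cast G.degree_le j
        exact mul_le_mul h1 (hC j) (Finset.sum_nonneg fun f _ => (hy _).1) (Nat.cast_nonneg d)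
    _ = (d : ℝ) * m * C := by simp; ring

lemma isActionSet_virtualActions (G : Network n m d) (N C : ℕ) :
    IsActionSet (virtualActions G N C) ((d : ℝ) * m * C) where
  nonempty := ⟨_, _, zero_mem_Zrel G N C, rfl⟩
  nonneg := by rintro _ ⟨b, hb, rfl⟩ p; exact (hb.2.1 p).1
  le_one := by rintro _ ⟨b, hb, rfl⟩ p; exact (hb.2.1 p).2
  sum_le := by rintro _ ⟨b, hb, rfl⟩; exact sum_le_of_mem_Zrel G hb

lemma IsRequest.nonneg {x : UserVec n N} (hx : IsRequest x) (p) : 0 ≤ x p := by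
  rcases hx.1 p with h | h <;> simp [h]

lemma IsRequest.le_one {x : UserVec n N} (hx : IsRequest x) (p) : x p ≤ 1 := by
  rcases hx.1 p with h | h <;> simp [h]

lemma IsRequest.sum_le {x : UserVec n N} (hx : IsRequest x) : ∑ p, x p ≤ n := by
  rw [Fintype.sum_prod_type]
  exact (Finset.sum_le_sum fun i _ => hx.2 i).trans_eq (by simp)

lemma sum_virtualReward (x : ℕ → UserVec n N) (T : ℕ) (z : UserVec n N) :
    ∑ t ∈ Finset.Icc 1 T, virtualReward (x t) z = virtualReward (cumRequests x (T + 1)) z := by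
  have h : Finset.Ico 1 (T + 1) = Finset.Icc 1 T := by ext; simp
  simp only [virtualReward, cumRequests, h, Finset.sum_apply, Finset.sum_mul]
  rw [Finset.sum_comm]

lemma supportFn_virtualActions (G : Network n m d) (θ : UserVec n N) :
    sSup ((fun b : UserVec n N × CacheVec m N => virtualReward θ b.1) '' Zrel G N C) =
      supportFn (virtualActions G N C) θ := by
  rw [supportFn, virtualActions, Set.image_image]
  rfl

lemma virtualReward_nonneg (G : Network n m d) {x : UserVec n N} (hx : IsRequest x)
    {b : UserVec n N × CacheVec m N} (hb : b ∈ Zrel G N C) : 0 ≤ virtualReward x b.1 :=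
  Finset.sum_nonneg fun p _ => mul_nonneg (hx.nonneg p) (hb.2.1 p).1

lemma virtualReward_le (G : Network n m d) {x : UserVec n N} (hx : IsRequest x)
    {b : UserVec n N × CacheVec m N} (hb : b ∈ Zrel G N C) : virtualReward x b.1 ≤ n :=
  (Finset.sum_le_sum fun p _ => mul_le_of_le_one_right (hx.nonneg p) (hb.2.1 p).2).trans hx.sum_le

lemma physicalReward_le (G : Network n m d) {x : UserVec n N} (hx : IsRequest x)
    (y : CacheVec m N) : physicalReward G x y ≤ n := by
  refine le_trans ?_ hx.sum_le
  rw [Fintype.sum_prod_type]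
  exact Finset.sum_le_sum fun i _ => Finset.sum_le_sum fun f _ =>
    mul_le_of_le_one_right (hx.nonneg _) (min_le_left _ _)

lemma virtualReward_le_physicalReward (G : Network n m d) {x : UserVec n N} (hx : IsRequest x)
    {b : UserVec n N × CacheVec m N} (hb : b ∈ Zrel G N C) :
    virtualReward x b.1 ≤ physicalReward G x b.2 := by
  rw [virtualReward, Fintype.sum_prod_type]
  exact Finset.sum_le_sum fun i _ => Finset.sum_le_sum fun f _ =>
    mul_le_mul_of_nonneg_left (le_min (hb.2.1 _).2 (hb.2.2 i f)) (hx.nonneg _)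

/-- The largest virtual configuration supported by a physical configuration. -/
noncomputable def supportedBy (G : Network n m d) (y : CacheVec m N) : UserVec n N :=
  fun p => min 1 (∑ j ∈ G.cachesOf p.1, y (j, p.2))

lemma supportedBy_mem_Zrel (G : Network n m d) {y : CacheVec m N} (hy : y ∈ Yrel m N C) :
    (supportedBy G y, y) ∈ Zrel G N C :=
  ⟨hy, fun _ => ⟨le_min zero_le_one (Finset.sum_nonneg fun _ _ => (hy.1 _).1), min_le_left _ _⟩,
    fun _ _ => min_le_right _ _⟩

lemma virtualReward_supportedBy (G : Network n m d) (x : UserVec n N) (y : CacheVec m N) :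
    virtualReward x (supportedBy G y) = physicalReward G x y := by
  rw [virtualReward, Fintype.sum_prod_type]
  rfl

/-! ### Regret of the policy -/

section Policy

universe u

variable {G : Network n m d} {η : ℕ → ℝ} {x : ℕ → UserVec n N} {Ω : Type u} [MeasurableSpace Ω]
  {P : Measure Ω} {γ : Ω → UserVec n N} {a : ℕ → Ω → UserVec n N × CacheVec m N}

namespace IsRelaxedLeadCache

lemma integrable_virtualReward [IsProbabilityMeasure P] (ha : IsRelaxedLeadCache G C η x P γ a)
    (hx : ∀ t, IsRequest (x t)) {t : ℕ} (ht : 1 ≤ t) :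
    Integrable (fun ω => virtualReward (x t) (a t ω).1) P := by
  have hm : Measurable fun b : UserVec n N × CacheVec m N => virtualReward (x t) b.1 := by
    unfold virtualReward; fun_prop
  refine .of_bound (hm.comp_aemeasurable (ha.aemeasurable t ht)).aestronglyMeasurable n ?_
  filter_upwards [ha.maximizer t ht] with ω hω
  rw [Real.norm_of_nonneg (virtualReward_nonneg G (hx t) hω.1)]
  exact virtualReward_le G (hx t) hω.1

lemma integrable_physicalReward [IsProbabilityMeasure P] (ha : IsRelaxedLeadCache G C η x P γ a)
    (hx : ∀ t, IsRequest (x t)) {t : ℕ} (ht : 1 ≤ t) :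
    Integrable (fun ω => physicalReward G (x t) (a t ω).2) P := by
  have hm : Measurable fun b : UserVec n N × CacheVec m N => physicalReward G (x t) b.2 := by
    unfold physicalReward; fun_prop
  refine .of_bound (hm.comp_aemeasurable (ha.aemeasurable t ht)).aestronglyMeasurable n ?_
  filter_upwards [ha.maximizer t ht] with ω hω
  rw [Real.norm_of_nonneg ((virtualReward_nonneg G (hx t) hω.1).trans
    (virtualReward_le_physicalReward G (hx t) hω.1))]
  exact physicalReward_le G (hx t) _

/-- Every fixed `y` is matched by the virtual action `supportedBy G y` of equal reward, while the
policy's own cache hits are at least its virtual reward. -/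
lemma physicalRegret_le_virtualRegret [IsProbabilityMeasure P]
    (ha : IsRelaxedLeadCache G C η x P γ a) (hx : ∀ t, IsRequest (x t)) (T : ℕ) :
    expectedPhysicalRegret G C x P a T ≤ expectedVirtualRegret G C x P a T := by
  refine sub_le_sub ?_ ?_
  · refine csSup_le (Set.Nonempty.image _ ⟨_, (zero_mem_Zrel G N C).1⟩) ?_
    rintro _ ⟨y, hy, rfl⟩
    refine le_csSup ⟨∑ t ∈ Finset.Icc 1 T, (n : ℝ), ?_⟩ ⟨_, supportedBy_mem_Zrel G hy, ?_⟩
    · rintro _ ⟨b, hb, rfl⟩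
      exact Finset.sum_le_sum fun t _ => virtualReward_le G (hx t) hb
    · simp only [virtualReward_supportedBy]
  · refine integral_mono_ae
      (integrable_finsetSum _ fun t ht => ha.integrable_virtualReward hx (Finset.mem_Icc.1 ht).1)
      (integrable_finsetSum _ fun t ht => ha.integrable_physicalReward hx (Finset.mem_Icc.1 ht).1) ?_
    have h : ∀ᵐ ω ∂P, ∀ t, 1 ≤ t → a t ω ∈ Zrel G N C :=
      ae_all_iff.2 fun t => Filter.eventually_imp_distrib_left.2 fun ht =>
        (ha.maximizer t ht).mono fun ω hω => hω.1
    filter_upwards [h] with ω hω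
    exact Finset.sum_le_sum fun t ht =>
      virtualReward_le_physicalReward G (hx t) (hω t (Finset.mem_Icc.1 ht).1)

/-- The requests are fixed in advance, so `cumRequests x t` is deterministic and only the law of `γ`
matters. Hence one draw of `γ` serves all slots, and the bound holds for any choice among the
maximizers. -/
lemma perturbedValue_sub_le_integral [IsProbabilityMeasure P]
    (ha : IsRelaxedLeadCache G C η x P γ a) (hx : ∀ t, IsRequest (x t)) {t : ℕ} (ht : 1 ≤ t) :
    perturbedValue (virtualActions G N C) (cumRequests x t) (η t) -
        perturbedValue (virtualActions G N C) (cumRequests x t - x t) (η t) ≤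
      ∫ ω, virtualReward (x t) (a t ω).1 ∂P := by
  have hS := isActionSet_virtualActions G N C
  have h1 := hS.integrable_supportFn (cumRequests x t) (η t)
  have h2 := hS.integrable_supportFn (cumRequests x t - x t) (η t)
  have hi := h1.sub h2
  rw [perturbedValue, perturbedValue, ← integral_sub h1 h2, stdGauss, ← ha.gaussian.map_eq,
    integral_map ha.gaussian.aemeasurable (by rw [ha.gaussian.map_eq]; exact hi.aestronglyMeasurable)]
  rw [stdGauss, ← ha.gaussian.map_eq] at hi
  refine integral_mono_ae (hi.comp_aemeasurable ha.gaussian.aemeasurable)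
    (ha.integrable_virtualReward hx ht) ?_
  filter_upwards [ha.maximizer t ht] with ω hω
  have h3 := hS.supportFn_sub_le_reward (θ := cumRequests x t + η t • γ ω) (x t)
    ⟨_, hω.1, rfl⟩ (hS.supportFn_le (by rintro _ ⟨b, hb, rfl⟩; exact hω.2 b hb))
  rw [add_sub_right_comm] at h3
  exact h3

end IsRelaxedLeadCache

/-- Telescoping of 1/√t ≤ 2(√t − √(t−1)). -/
lemma sum_inv_sqrt_le (T : ℕ) : ∑ t ∈ Finset.Icc 1 T, (1 / √(t : ℝ)) ≤ 2 * √(T : ℝ) := by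
  induction T with
  | zero => simp
  | succ T ih =>
    rw [Finset.sum_Icc_succ_top (by omega)]
    have h0 : 0 < √((T + 1 : ℕ) : ℝ) := Real.sqrt_pos.2 (by positivity)
    have h1 : √((T + 1 : ℕ) : ℝ) ^ 2 = T + 1 := by rw [Real.sq_sqrt (by positivity)]; simp
    have h2 : √(T : ℝ) ^ 2 = T := Real.sq_sqrt (by positivity)
    have h3 : 1 / √((T + 1 : ℕ) : ℝ) ≤ 2 * √((T + 1 : ℕ) : ℝ) - 2 * √(T : ℝ) := by
      rw [div_le_iff₀ h0]
      nlinarith [sq_nonneg (√((T + 1 : ℕ) : ℝ) - √(T : ℝ))]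
    linarith

/-- The regret of LeadCache for learning rates `β √t`. -/
lemma IsRelaxedLeadCache.expectedVirtualRegret_le [IsProbabilityMeasure P] {β : ℝ} (hβ : 0 < β)
    (hn : 0 < n) (hN : 0 < N)
    (ha : IsRelaxedLeadCache G C (fun t => β * √(t : ℝ)) x P γ a)
    (hx : ∀ t, IsRequest (x t)) (T : ℕ) :
    expectedVirtualRegret G C x P a T ≤
      β * √T * ((d : ℝ) * m * C * (Real.log ((N : ℝ) * n) + 2)) + 4 * (n * √n) * √T / β := by
  have hS := isActionSet_virtualActions G N C
  have : Nonempty (Fin n × Fin N) := ⟨(⟨0, hn⟩, ⟨0, hN⟩)⟩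
  have hW := hS.perturbedValue_zero_one_le
  have hcard : ((Fintype.card (Fin n × Fin N) : ℕ) : ℝ) = (N : ℝ) * n := by simp [mul_comm]
  rw [hcard] at hW
  have hsum := hS.perturbedValue_sum_le (X := cumRequests x) (x := x) (c := fun t => β * √(t : ℝ))
    (B := n) (by simp [cumRequests])
    (fun t ht => by simp only [cumRequests]; rw [Finset.sum_Ico_succ_top ht]) (by simp)
    (fun s t hst => mul_le_mul_of_nonneg_left (Real.sqrt_le_sqrt (by exact_mod_cast hst)) hβ.le)
    (fun t ht => mul_pos hβ (Real.sqrt_pos.2 (by exact_mod_cast ht)))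
    (fun t => (hx t).nonneg) (fun t => (hx t).le_one) (fun t => (hx t).sum_le) T
  have hrew : ∑ t ∈ Finset.Icc 1 T,
      (perturbedValue (virtualActions G N C) (cumRequests x t) (β * √(t : ℝ)) -
        perturbedValue (virtualActions G N C) (cumRequests x t - x t) (β * √(t : ℝ))) ≤
      ∫ ω, ∑ t ∈ Finset.Icc 1 T, virtualReward (x t) (a t ω).1 ∂P := by
    rw [integral_finsetSum _ fun t ht => ha.integrable_virtualReward hx (Finset.mem_Icc.1 ht).1]
    exact Finset.sum_le_sum fun t ht => ha.perturbedValue_sub_le_integral hx (Finset.mem_Icc.1 ht).1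
  have hnoise : ∑ t ∈ Finset.Icc 1 T, 2 * (n : ℝ) * (√n / (β * √(t : ℝ))) ≤
      4 * (n * √n) * √T / β := by
    have h : ∀ t : ℕ, 2 * (n : ℝ) * (√n / (β * √(t : ℝ))) = 2 * n * √n / β * (1 / √(t : ℝ)) :=
      fun t => by rw [div_mul_div_comm, mul_one, mul_div_assoc]
    simp only [h, ← Finset.mul_sum]
    calc _ ≤ 2 * n * √n / β * (2 * √(T : ℝ)) := by gcongr; exact sum_inv_sqrt_le T
      _ = _ := by ring
  have hJ := hS.supportFn_le_perturbedValue (cumRequests x (T + 1)) (β * √(T : ℝ))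
  have hW' := mul_le_mul_of_nonneg_left hW (by positivity : 0 ≤ β * √(T : ℝ))
  unfold expectedVirtualRegret
  simp only [sum_virtualReward x T]
  rw [supportFn_virtualActions]
  linarith

lemma IsRelaxedLeadCache.expectedVirtualRegret_nonpos [IsProbabilityMeasure P]
    (ha : IsRelaxedLeadCache G C η x P γ a) (hx : ∀ t, IsRequest (x t))
    (h0 : ∀ b ∈ Zrel G N C, b.1 = 0) (T : ℕ) : expectedVirtualRegret G C x P a T ≤ 0 := by
  have h1 : 0 ≤ ∫ ω, ∑ t ∈ Finset.Icc 1 T, virtualReward (x t) (a t ω).1 ∂P := by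
    rw [integral_finsetSum _ fun t ht => ha.integrable_virtualReward hx (Finset.mem_Icc.1 ht).1]
    exact Finset.sum_nonneg fun t ht => integral_nonneg_of_ae <|
      (ha.maximizer t (Finset.mem_Icc.1 ht).1).mono fun ω hω => virtualReward_nonneg G (hx t) hω.1
  refine sub_nonpos.2 (le_trans ?_ h1)
  refine csSup_le (Set.Nonempty.image _ ⟨_, zero_mem_Zrel G N C⟩) ?_
  rintro _ ⟨b, hb, rfl⟩
  simp [h0 b hb, virtualReward]

lemma fst_eq_zero_of_mem_Zrel (h : ¬ (0 < n ∧ 0 < N ∧ 0 < (d : ℝ) * m * C))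
    {b : UserVec n N × CacheVec m N} (hb : b ∈ Zrel G N C) : b.1 = 0 := by
  ext p
  have hn : 0 < n := p.1.pos
  have hN : 0 < N := p.2.pos
  have hA : (d : ℝ) * m * C ≤ 0 := not_lt.1 fun hA => h ⟨hn, hN, hA⟩
  exact le_antisymm (((Finset.single_le_sum (fun q _ => (hb.2.1 q).1) (Finset.mem_univ p)).trans
    (sum_le_of_mem_Zrel G hb)).trans hA) (hb.2.1 p).1

end Policy

end Caching

end LeadCache

/-! ### Choice of the learning rate and conclusion -/

theorem mainTheorem5 :
    ∃ K : ℝ, 0 < K ∧ ∃ k : ℕ, ∀ n m N C d : ℕ, ∃ β : ℝ, 0 < β ∧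
      ∀ (G : LeadCache.Network n m d) (x : ℕ → LeadCache.UserVec n N),
        (∀ t, LeadCache.IsRequest (x t)) →
      ∀ (Ω : Type*) [MeasurableSpace Ω] (P : Measure Ω) [IsProbabilityMeasure P]
        (γ : Ω → LeadCache.UserVec n N)
        (a : ℕ → Ω → LeadCache.UserVec n N × LeadCache.CacheVec m N),
        LeadCache.IsRelaxedLeadCache G C (fun t => β * Real.sqrt (t : ℝ)) x P γ a →
      ∀ T : ℕ,
        LeadCache.expectedVirtualRegret G C x P a T ≤
            K * (1 + Real.log ((N : ℝ) * (n : ℝ))) ^ k * (n : ℝ) ^ (3 / 4 : ℝ) *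
              Real.sqrt ((d : ℝ) * m * C * T) ∧
        LeadCache.expectedPhysicalRegret G C x P a T ≤
            K * (1 + Real.log ((N : ℝ) * (n : ℝ))) ^ k * (n : ℝ) ^ (3 / 4 : ℝ) *
              Real.sqrt ((d : ℝ) * m * C * T) := by
  -- The two losses add up to r√(AT)(ln(Nn) + 2 + 4), and ln(Nn) + 6 ≤ 6(1 + ln(Nn)).
  refine ⟨6, by norm_num, 1, fun n m N C d => ?_⟩
  have hlog : 0 ≤ Real.log ((N : ℝ) * n) := by exact_mod_cast Real.log_natCast_nonneg (N * n)
  by_cases h : 0 < n ∧ 0 < N ∧ 0 < (d : ℝ) * m * C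
  · obtain ⟨hn, hN, hA⟩ := h
    set A : ℝ := (d : ℝ) * m * C with hAdef
    set r : ℝ := (n : ℝ) ^ (3 / 4 : ℝ) with hr
    have hn' : (0 : ℝ) < n := by exact_mod_cast hn
    have hr0 : 0 < r := Real.rpow_pos_of_pos hn' _
    have hsA : 0 < √A := Real.sqrt_pos.2 hA
    have hrr : (n : ℝ) * √n = r * r := by
      rw [hr, ← Real.rpow_add hn', Real.sqrt_eq_rpow, ← Real.rpow_one_add' hn'.le (by norm_num)]
      norm_num
    -- Up to the logarithm, this `β` equalizes βA√T and r²√T/β, where r² = n√n.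
    refine ⟨r / √A, by positivity, fun G x hx Ω _ P _ γ a ha T => ?_⟩
    have hmain : LeadCache.expectedVirtualRegret G C x P a T ≤
        6 * (1 + Real.log ((N : ℝ) * n)) ^ 1 * r * √(A * T) := by
      refine (ha.expectedVirtualRegret_le (by positivity) hn hN hx T).trans ?_
      rw [Real.sqrt_mul hA.le, ← hAdef, hrr]
      have h1 : r / √A * √T * (A * (Real.log ((N : ℝ) * n) + 2)) =
          r * √A * √T * (Real.log ((N : ℝ) * n) + 2) := by
        nth_rewrite 2 [← Real.mul_self_sqrt hA.le]
        field_simp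
      have h2 : 4 * (r * r) * √T / (r / √A) = r * √A * √T * 4 := by field_simp
      have h3 : 0 ≤ r * √A * √T * Real.log ((N : ℝ) * n) := by positivity
      rw [h1, h2]
      linarith
    exact ⟨hmain, (ha.physicalRegret_le_virtualRegret hx T).trans hmain⟩
  -- In the degenerate cases the only virtual configuration is zero, so the regret is at most zero
  -- for any learning rate.
  · refine ⟨1, one_pos, fun G x hx Ω _ P _ γ a ha T => ?_⟩
    have h0 := ha.expectedVirtualRegret_nonpos hx
      (fun b hb => LeadCache.fst_eq_zero_of_mem_Zrel h hb) T
    have hpos : 0 ≤ 6 * (1 + Real.log ((N : ℝ) * (n : ℝ))) ^ 1 * (n : ℝ) ^ (3 / 4 : ℝ) *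
        √((d : ℝ) * m * C * T) := by positivity
    exact ⟨h0.trans hpos, ((ha.physicalRegret_le_virtualRegret hx T).trans h0).trans hpos⟩
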